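/- A $3$-graph is a finite hypergraph $H$ (without repeated edges) all of whose edges have exactly three vertices; it is linear if any two distinct edges have at most one vertex in common. A $3$-cut of $H$ is given by a partition of the vertex set into three (possibly empty) parts, and its size is the number of edges having a vertex in each part. The co-degree of a pair of distinct vertices is the number of edges containing both of them. **Theorem.** (a) There is an absolute constant $c>0$ such that every linear $3$-graph with $m\ge 2$ edges has a $3$-cut of size at least $$\frac{2}{9}\,m+c\,\frac{m^{3/4}}{(\log m)^2}.$$ (b) The exponent $3/4$ is attained by almost linear $3$-graphs, in the following sense: there are absolute constants $c',C>0$ such that for every sufficiently large $n$ there is a $3$-graph on $n$ vertices whose number of edges $m$ satisfies $c'n^2\le m\le Cn^2$, in which every co-degree is at most $C\log n$, and in which every $3$-cut has size at most $$\frac{2}{9}\,m+C\,m^{3/4}.$$ -/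

import Mathlib

open Filter

namespace Hypergraph

/-- `H` is `r`-uniform (an `r`-graph): every edge has exactly `r` vertices. Since `H.edgeSet` is a
set of vertex sets, there are no repeated edges. -/
def IsUniform {α : Type*} (H : Hypergraph α) (r : ℕ) : Prop :=
  ∀ e ∈ H.edgeSet, e.encard = r

/-- `H` is linear: two distinct edges have at most one vertex in common. -/
def IsLinear {α : Type*} (H : Hypergraph α) : Prop :=
  ∀ e ∈ H.edgeSet, ∀ f ∈ H.edgeSet, e ≠ f → (e ∩ f).encard ≤ 1

/-- The number of edges of `H`. -/
noncomputable def numEdges {α : Type*} (H : Hypergraph α) : ℕ :=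
  H.edgeSet.ncard

/-- The co-degree of the pair `u, v`: the number of edges that contain both of them. -/
noncomputable def codegree {α : Type*} (H : Hypergraph α) (u v : α) : ℕ :=
  {e ∈ H.edgeSet | u ∈ e ∧ v ∈ e}.ncard

/-- `P 0, …, P (k - 1)` is a partition of the vertex set of `H` into `k` (possibly empty) parts. -/
def IsVertexPartition {α : Type*} (H : Hypergraph α) {k : ℕ} (P : Fin k → Set α) : Prop :=
  (∀ i j, i ≠ j → Disjoint (P i) (P j)) ∧ ⋃ i, P i = H.vertexSet

/-- The size of the `k`-cut given by the parts `P 0, …, P (k - 1)`: the number of edges of `H` with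
at least one vertex in each part. -/
noncomputable def cutSize {α : Type*} (H : Hypergraph α) {k : ℕ} (P : Fin k → Set α) : ℕ :=
  {e ∈ H.edgeSet | ∀ i, (e ∩ P i).Nonempty}.ncard

end Hypergraph

/-!
**Large cuts of linear 3-graphs.** Colour each vertex `v` independently at random, with
probabilities `1/3 + σ_v/12 + x_v`, `1/3 + σ_v/12 - x_v`, `1/3 - σ_v/6` for the three colours. Here
the `σ_v` are uniformly random signs and `x = s (1 + t N) ε`, where the `ε_v` are further random
signs and `N` is the matrix with `N_uv = σ_w` whenever `{u, v, w}` is an edge. On average over `σ`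
and `ε`, the terms of the expected cut size that exceed the trivial `2m/9` are
`-x_u x_v (1/3 - σ_w/6)` over the (ordered) edges. The mean of `x_u x_v` is a combination of the
means of `N_uv` and `(N²)_uv`; the latter vanishes because in a linear 3-graph distinct vertices
`u`, `v` do not form edges with the same pair. On the other hand `x_u x_v` is positively correlated
with `σ_w` through the term `2 t N_uv = 2 t σ_w`, and this produces a gain of order `s² t` for every
edge (`expect_tripleValue`). The `x_v` have to stay bounded. They are sub-Gaussian with variance
`s²` up to a constant if `t²` is at most the inverse of the degrees, so `s² ~ 1 / log m` suffices
(`exists_signs`). Vertices of degree above a multiple of `√m` get `x_v = 0`: by linearity at least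
half of the edges contain at most one of them (`le_edgeSum_lowVertices`), so that one may take
`t ~ m ^ (-1/4)` and gains `m ^ (3/4) / log m` altogether (`exists_fractional_colouring`).

**Almost linear 3-graphs without large cuts.** Choose every triple of an `n`-set with probability
`1/n`. There are `3 ^ n` colourings, each with at most `n³/27` rainbow triples, and by Chernoff's
bound each cut exceeds its mean by a large multiple of `n ^ (3/2)` with probability much smaller
than `3 ^ (-n)`. The number of edges and the co-degrees are controlled in the same way
(`exists_triples`).
-/

open scoped BigOperators

/-! ### Averages over random signs -/

/-- The set of all sign vectors `ω : V → {1, -1}`; averaging over it is taking the expectation over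
independent uniformly random signs. -/
noncomputable def signVectors (V : Type*) [Fintype V] [DecidableEq V] : Finset (V → ℝ) :=
  Fintype.piFinset fun _ => {1, -1}

section Signs

variable {V : Type*} [Fintype V] [DecidableEq V]

lemma mem_signVectors {ω : V → ℝ} : ω ∈ signVectors V ↔ ∀ v, ω v = 1 ∨ ω v = -1 := by
  simp [signVectors]

lemma signVectors_nonempty : (signVectors V).Nonempty :=
  ⟨fun _ => 1, mem_signVectors.2 fun _ => Or.inl rfl⟩

lemma sq_eq_one_of_mem_signVectors {ω : V → ℝ} (h : ω ∈ signVectors V) (v : V) :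
    ω v * ω v = 1 := by
  rcases mem_signVectors.1 h v with h | h <;> simp [h]

lemma abs_eq_one_of_mem_signVectors {ω : V → ℝ} (h : ω ∈ signVectors V) (v : V) :
    |ω v| = 1 := by
  rcases mem_signVectors.1 h v with h | h <;> simp [h]

lemma expect_signVectors_prod (f : V → ℝ → ℝ) :
    𝔼 ω ∈ signVectors V, ∏ v, f v (ω v) = ∏ v, (f v 1 + f v (-1)) / 2 := by
  rw [Finset.expect_eq_sum_div_card, signVectors, ← Finset.prod_univ_sum, Fintype.card_piFinset,
    Finset.prod_div_distrib]
  have h : (1 : ℝ) ≠ -1 := by norm_num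
  simp [Finset.sum_pair h, Finset.card_pair h]

lemma expect_signVectors_mul (a b : V) :
    𝔼 ω ∈ signVectors V, ω a * ω b = if a = b then 1 else 0 := by
  split_ifs with h
  · subst h
    rw [Finset.expect_congr rfl fun ω hω => sq_eq_one_of_mem_signVectors hω a,
      Finset.expect_const signVectors_nonempty]
  · have key := expect_signVectors_prod (V := V)
      fun v x => (if a = v then x else 1) * (if b = v then x else 1)
    simp only [Finset.prod_mul_distrib, Finset.prod_ite_eq, Finset.mem_univ, if_true] at key
    rw [key]
    refine Finset.prod_eq_zero (Finset.mem_univ a) ?_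
    simp [Ne.symm h]

lemma expect_signVectors_odd (φ : (V → ℝ) → ℝ) (h : ∀ ω, φ (-ω) = -φ ω) :
    𝔼 ω ∈ signVectors V, φ ω = 0 := by
  have key : 𝔼 ω ∈ signVectors V, φ ω = 𝔼 ω ∈ signVectors V, -φ ω := by
    refine Finset.expect_nbij' (fun ω => -ω) (fun ω => -ω) ?_ ?_ ?_ ?_ ?_
    · intro ω hω
      exact mem_signVectors.2 fun v => by
        rcases mem_signVectors.1 hω v with h | h <;> simp [h]
    · intro ω hω
      exact mem_signVectors.2 fun v => by
        rcases mem_signVectors.1 hω v with h | h <;> simp [h]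
    · simp
    · simp
    · intro ω _
      rw [h, neg_neg]
  rw [Finset.expect_neg_distrib] at key
  linarith

/-- The exponential moment of a Rademacher sum is sub-Gaussian. -/
lemma expect_signVectors_exp_le (c : V → ℝ) :
    𝔼 ω ∈ signVectors V, Real.exp (∑ v, c v * ω v) ≤ Real.exp ((∑ v, c v ^ 2) / 2) := by
  simp only [Real.exp_sum]
  rw [expect_signVectors_prod fun v x => Real.exp (c v * x), Finset.sum_div, Real.exp_sum]
  refine Finset.prod_le_prod (fun v _ => by positivity) fun v _ => ?_
  have := Real.cosh_le_exp_half_sq (c v)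
  rw [Real.cosh_eq] at this
  simpa using this

lemma expect_signVectors_linear (c : V → ℝ) :
    𝔼 ω ∈ signVectors V, ∑ v, c v * ω v = 0 := by
  refine expect_signVectors_odd _ fun ω => ?_
  simp [Finset.sum_neg_distrib]

lemma expect_signVectors_linear_mul_linear (c d : V → ℝ) :
    𝔼 ω ∈ signVectors V, (∑ v, c v * ω v) * (∑ v, d v * ω v) = ∑ v, c v * d v := by
  simp only [Finset.sum_mul_sum, Finset.expect_sum_comm]
  refine Finset.sum_congr rfl fun a _ => ?_
  have h : ∀ (b : V) (ω : V → ℝ), c a * ω a * (d b * ω b) = c a * d b * (ω a * ω b) :=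
    fun b ω => by ring
  simp only [h, ← Finset.mul_expect, expect_signVectors_mul]
  simp

end Signs

/-! ### Tensors of linear 3-graphs -/

/-- `h` has the properties of the function with `h u v w = 1` if `{u, v, w}` is an edge of a given
linear 3-graph and `h u v w = 0` otherwise: it is a symmetric `0/1`-valued tensor, it vanishes on
triples with a repeated entry, and two entries determine the third one. -/
structure IsLinearTensor {V : Type*} (h : V → V → V → ℝ) : Prop where
  zero_or_one : ∀ u v w, h u v w = 0 ∨ h u v w = 1
  swap_left : ∀ u v w, h v u w = h u v w
  swap_right : ∀ u v w, h u w v = h u v w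
  diag : ∀ u w, h u u w = 0
  unique : ∀ u v w w', h u v w = 1 → h u v w' = 1 → w = w'

set_option linter.unusedSectionVars false

section Tensor

variable {V : Type*} [Fintype V] [DecidableEq V]

/-- The adjacency matrix of the graph whose edges are the pairs `u, a` lying in a hyperedge
`{u, a, w}`, signed by the sign of the third vertex `w`. -/
noncomputable def signedLink (h : V → V → V → ℝ) (σ : V → ℝ) (u a : V) : ℝ :=
  ∑ w, h u a w * σ w

/-- The number of ordered pairs completing `u` to an edge, that is, twice the degree of `u`. -/
noncomputable def orderedDegree (h : V → V → V → ℝ) (u : V) : ℝ :=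
  ∑ a, ∑ w, h u a w

/-- The matrix `1 + t N`, where `N` is the signed link matrix, restricted to the vertices in `L`. -/
noncomputable def correlationMatrix (h : V → V → V → ℝ) (L : Finset V) (t : ℝ) (σ : V → ℝ)
    (u a : V) : ℝ :=
  if u ∈ L then (if u = a then 1 else 0) + (if a ∈ L then t * signedLink h σ u a else 0) else 0

/-- The vector obtained by applying the correlation matrix to the sign vector `ε`. -/
noncomputable def perturbation (h : V → V → V → ℝ) (L : Finset V) (t : ℝ) (σ ε : V → ℝ)
    (u : V) : ℝ :=
  ∑ a, correlationMatrix h L t σ u a * ε a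

variable {h : V → V → V → ℝ} (L : Finset V) (t : ℝ) (σ ε : V → ℝ)

namespace IsLinearTensor

lemma nonneg (hh : IsLinearTensor h) (u v w : V) : 0 ≤ h u v w := by
  rcases hh.zero_or_one u v w with e | e <;> simp [e]

lemma ne_of_eq_one (hh : IsLinearTensor h) {u v w : V} (e : h u v w = 1) :
    u ≠ v ∧ v ≠ w ∧ u ≠ w := by
  refine ⟨?_, ?_, ?_⟩
  · rintro rfl
    simp [hh.diag] at e
  · rintro rfl
    rw [← hh.swap_left, hh.swap_right, hh.diag] at e
    simp at e
  · rintro rfl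
    rw [← hh.swap_right, hh.diag] at e
    simp at e

lemma sum_le_one (hh : IsLinearTensor h) (u a : V) : ∑ w, h u a w ≤ 1 := by
  by_cases H : ∃ w, h u a w = 1
  · obtain ⟨w, hw⟩ := H
    rw [Finset.sum_eq_single w]
    · exact hw.le
    · intro w' _ hne
      exact (hh.zero_or_one u a w').resolve_right fun e => hne (hh.unique u a w' w e hw)
    · simp
  · rw [Finset.sum_eq_zero]
    · exact zero_le_one
    · exact fun w _ => (hh.zero_or_one u a w).resolve_right fun e => H ⟨w, e⟩

lemma signedLink_symm (hh : IsLinearTensor h) (σ : V → ℝ) (u a : V) :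
    signedLink h σ a u = signedLink h σ u a := by
  simp [signedLink, hh.swap_left u a]

lemma signedLink_self (hh : IsLinearTensor h) (σ : V → ℝ) (u : V) : signedLink h σ u u = 0 := by
  simp [signedLink, hh.diag]

lemma abs_signedLink_le (hh : IsLinearTensor h) {σ : V → ℝ} (hσ : σ ∈ signVectors V) (u a : V) :
    |signedLink h σ u a| ≤ ∑ w, h u a w := by
  refine (Finset.abs_sum_le_sum_abs _ _).trans (Finset.sum_le_sum fun w _ => ?_)
  rw [abs_mul, abs_eq_one_of_mem_signVectors hσ, mul_one, abs_of_nonneg (hh.nonneg u a w)]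

end IsLinearTensor

lemma signedLink_neg (σ : V → ℝ) (u a : V) : signedLink h (-σ) u a = -signedLink h σ u a := by
  simp [signedLink, Finset.sum_neg_distrib]

lemma expect_signedLink (u a : V) : 𝔼 σ ∈ signVectors V, signedLink h σ u a = 0 :=
  expect_signVectors_linear _

lemma expect_sign_mul_signedLink (u a w : V) :
    𝔼 σ ∈ signVectors V, σ w * signedLink h σ u a = h u a w := by
  have key := expect_signVectors_linear_mul_linear (fun v => if w = v then 1 else 0) (h u a)
  simpa [signedLink] using key

/-- Distinct rows of the signed link matrix are uncorrelated: this is where linearity enters. -/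
lemma expect_signedLink_mul_signedLink (hh : IsLinearTensor h) {u v : V} (huv : u ≠ v) (a : V) :
    𝔼 σ ∈ signVectors V, signedLink h σ u a * signedLink h σ v a = 0 := by
  simp only [signedLink]
  rw [expect_signVectors_linear_mul_linear]
  refine Finset.sum_eq_zero fun w _ => ?_
  rcases hh.zero_or_one u a w with e | e
  · simp [e]
  rcases hh.zero_or_one v a w with e' | e'
  · simp [e']
  refine absurd (hh.unique a w u v ?_ ?_) huv
  · rw [hh.swap_right, hh.swap_left]; exact e
  · rw [hh.swap_right, hh.swap_left]; exact e'

lemma sum_correlationMatrix_mul (hh : IsLinearTensor h) {u v : V} (hu : u ∈ L) (hv : v ∈ L)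
    (huv : u ≠ v) :
    ∑ a, correlationMatrix h L t σ u a * correlationMatrix h L t σ v a =
      2 * t * signedLink h σ u v +
        t ^ 2 * ∑ a ∈ L, signedLink h σ u a * signedLink h σ v a := by
  have h1 : ∀ a, correlationMatrix h L t σ u a * correlationMatrix h L t σ v a =
      (if u = a then (if a ∈ L then t * signedLink h σ v a else 0) else 0) +
      (if v = a then (if a ∈ L then t * signedLink h σ u a else 0) else 0) +
      t ^ 2 * (if a ∈ L then signedLink h σ u a * signedLink h σ v a else 0) := by
    intro a
    simp only [correlationMatrix, hu, hv, if_true]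
    by_cases e1 : u = a
    · subst e1
      simp [huv.symm, hu, hh.signedLink_self]
    · by_cases e2 : v = a
      · subst e2
        simp [huv, hv, hh.signedLink_self]
      · by_cases e3 : a ∈ L
        · simp [e1, e2, e3]; ring
        · simp [e1, e2, e3]
  simp only [h1, Finset.sum_add_distrib, ← Finset.mul_sum, Finset.sum_ite_eq, Finset.mem_univ,
    if_true, hu, hv, hh.signedLink_symm σ u v, Finset.sum_ite_mem, Finset.univ_inter]
  ring

lemma correlationMatrix_of_mem (hh : IsLinearTensor h) {u : V} (hu : u ∈ L) (a : V) :
    correlationMatrix h L t σ u a = if u = a then 1 else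
      if a ∈ L then t * signedLink h σ u a else 0 := by
  simp only [correlationMatrix, hu, if_true]
  split_ifs with h1 h2
  · subst h1
    simp [hh.signedLink_self]
  all_goals simp

lemma sum_sq_correlationMatrix_le (hh : IsLinearTensor h) {σ : V → ℝ} (hσ : σ ∈ signVectors V)
    {u : V} (hu : u ∈ L) :
    ∑ a, correlationMatrix h L t σ u a ^ 2 ≤ 1 + t ^ 2 * orderedDegree h u := by
  have key : ∀ a, correlationMatrix h L t σ u a ^ 2 ≤
      (if u = a then 1 else 0) + t ^ 2 * ∑ w, h u a w := by
    intro a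
    have h0 : 0 ≤ ∑ w, h u a w := Finset.sum_nonneg fun w _ => hh.nonneg u a w
    rw [correlationMatrix_of_mem L t σ hh hu]
    split_ifs with h1 h2
    · have : 0 ≤ t ^ 2 * ∑ w, h u a w := by positivity
      linarith
    · have h3 : signedLink h σ u a ^ 2 ≤ ∑ w, h u a w := by
        rw [← sq_abs]
        have := hh.abs_signedLink_le hσ u a
        have := hh.sum_le_one u a
        have := abs_nonneg (signedLink h σ u a)
        nlinarith
      rw [mul_pow, zero_add]
      gcongr
    · simp only [ne_eq, OfNat.ofNat_ne_zero, not_false_eq_true, zero_pow, zero_add]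
      positivity
  refine (Finset.sum_le_sum fun a _ => key a).trans_eq ?_
  simp [Finset.sum_add_distrib, ← Finset.mul_sum, orderedDegree]

lemma abs_perturbation_le (hh : IsLinearTensor h) (ht : 0 ≤ t) {σ ε : V → ℝ}
    (hσ : σ ∈ signVectors V) (hε : ε ∈ signVectors V) {u : V} (hu : u ∈ L) :
    |perturbation h L t σ ε u| ≤ 1 + t * orderedDegree h u := by
  have key : ∀ a, |correlationMatrix h L t σ u a * ε a| ≤
      (if u = a then 1 else 0) + t * ∑ w, h u a w := by
    intro a
    have h0 : 0 ≤ ∑ w, h u a w := Finset.sum_nonneg fun w _ => hh.nonneg u a w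
    rw [correlationMatrix_of_mem L t σ hh hu, abs_mul, abs_eq_one_of_mem_signVectors hε, mul_one]
    split_ifs with h1 h2
    · rw [abs_one]
      have : 0 ≤ t * ∑ w, h u a w := by positivity
      linarith
    · rw [abs_mul, abs_of_nonneg ht, zero_add]
      gcongr
      exact hh.abs_signedLink_le hσ u a
    · rw [abs_zero]
      positivity
  refine (Finset.abs_sum_le_sum_abs _ _).trans ((Finset.sum_le_sum fun a _ => key a).trans_eq ?_)
  simp [Finset.sum_add_distrib, ← Finset.mul_sum, orderedDegree]

lemma perturbation_of_notMem {u : V} (hu : u ∉ L) : perturbation h L t σ ε u = 0 := by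
  simp [perturbation, correlationMatrix, hu]

/-- A perturbation at a vertex of degree at most of order `1 / t ^ 2` is sub-Gaussian. -/
lemma expect_exp_perturbation_le (hh : IsLinearTensor h) {σ : V → ℝ} (hσ : σ ∈ signVectors V)
    {u : V} (hu : u ∈ L) (htu : t ^ 2 * orderedDegree h u ≤ 1) (l : ℝ) :
    𝔼 ε ∈ signVectors V, Real.exp (l * perturbation h L t σ ε u) ≤ Real.exp (l ^ 2) := by
  have key := expect_signVectors_exp_le fun a => l * correlationMatrix h L t σ u a
  simp only [perturbation, Finset.mul_sum, ← mul_assoc]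
  refine key.trans (Real.exp_le_exp.2 ?_)
  simp only [mul_pow, ← Finset.mul_sum]
  have := sum_sq_correlationMatrix_le L t hh hσ hu
  nlinarith [sq_nonneg l]

/-! ### The expected value of the random fractional cut -/

lemma expect_perturbation_mul (u v : V) :
    𝔼 ε ∈ signVectors V, perturbation h L t σ ε u * perturbation h L t σ ε v =
      ∑ a, correlationMatrix h L t σ u a * correlationMatrix h L t σ v a :=
  expect_signVectors_linear_mul_linear _ _

/-- The correlation of the perturbations at two vertices of an edge with the sign of the third
vertex is `2 t`. -/
lemma expect_sum_correlationMatrix_mul (hh : IsLinearTensor h) {u v w : V} (e : h u v w = 1) :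
    𝔼 σ ∈ signVectors V, (∑ a, correlationMatrix h L t σ u a * correlationMatrix h L t σ v a) *
      (1 / 3 - σ w / 6) = if u ∈ L ∧ v ∈ L then -(t / 3) else 0 := by
  have huv := (hh.ne_of_eq_one e).1
  split_ifs with H
  · simp only [sum_correlationMatrix_mul L t _ hh H.1 H.2 huv]
    have h1 : ∀ σ : V → ℝ, (2 * t * signedLink h σ u v +
        t ^ 2 * ∑ a ∈ L, signedLink h σ u a * signedLink h σ v a) * (1 / 3 - σ w / 6) =
        2 * t / 3 * signedLink h σ u v - t / 3 * (σ w * signedLink h σ u v) +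
        t ^ 2 / 3 * (∑ a ∈ L, signedLink h σ u a * signedLink h σ v a) -
        t ^ 2 / 6 * ((∑ a ∈ L, signedLink h σ u a * signedLink h σ v a) * σ w) := by
      intro σ; ring
    simp only [h1, Finset.expect_add_distrib, Finset.expect_sub_distrib, ← Finset.mul_expect,
      Finset.expect_sum_comm]
    rw [expect_signedLink, expect_sign_mul_signedLink, e,
      Finset.sum_eq_zero fun a _ => expect_signedLink_mul_signedLink hh huv a,
      expect_signVectors_odd]
    · ring
    · intro σ
      simp [signedLink_neg]
  · have h0 : ∀ σ : V → ℝ,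
        ∑ a, correlationMatrix h L t σ u a * correlationMatrix h L t σ v a = 0 := by
      intro σ
      refine Finset.sum_eq_zero fun a _ => ?_
      rcases not_and_or.1 H with H | H <;> simp [correlationMatrix, H]
    simp [h0]

lemma expect_prod_signs {u v w : V} (huv : u ≠ v) (hvw : v ≠ w) (huw : u ≠ w) :
    𝔼 σ ∈ signVectors V, (1 / 3 + σ u / 12) * (1 / 3 + σ v / 12) * (1 / 3 - σ w / 6) =
      1 / 27 := by
  have h1 : ∀ σ : V → ℝ, (1 / 3 + σ u / 12) * (1 / 3 + σ v / 12) * (1 / 3 - σ w / 6) =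
      1 / 27 + 1 / 432 * (σ u * σ v) - 1 / 216 * (σ u * σ w) - 1 / 216 * (σ v * σ w) +
      (1 / 108 * σ u + 1 / 108 * σ v - 1 / 54 * σ w - 1 / 864 * (σ u * σ v * σ w)) := by
    intro σ; ring
  simp only [h1]
  rw [Finset.expect_add_distrib, expect_signVectors_odd fun σ =>
    (1 / 108 * σ u + 1 / 108 * σ v - 1 / 54 * σ w - 1 / 864 * (σ u * σ v * σ w))]
  · simp only [Finset.expect_add_distrib, Finset.expect_sub_distrib, ← Finset.mul_expect,
      expect_signVectors_mul, huv, hvw, huw, Finset.expect_const signVectors_nonempty, if_false]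
    ring
  · intro σ
    simp only [Pi.neg_apply]
    ring

/-- The probability that `u, v, w` get the colours `0, 1, 2` in the fractional colouring with
weights `1/3 + σ/12 + x`, `1/3 + σ/12 - x`, `1/3 - σ/6`, where `x` is `s` times the perturbation. -/
noncomputable def tripleValue (h : V → V → V → ℝ) (L : Finset V) (t s : ℝ) (σ ε : V → ℝ)
    (u v w : V) : ℝ :=
  (1 / 3 + σ u / 12 + s * perturbation h L t σ ε u) *
    (1 / 3 + σ v / 12 - s * perturbation h L t σ ε v) * (1 / 3 - σ w / 6)

lemma expect_tripleValue (s : ℝ) (hh : IsLinearTensor h) {u v w : V} (e : h u v w = 1) :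
    𝔼 σ ∈ signVectors V, 𝔼 ε ∈ signVectors V, tripleValue h L t s σ ε u v w =
      1 / 27 + if u ∈ L ∧ v ∈ L then s ^ 2 * t / 3 else 0 := by
  obtain ⟨huv, hvw, huw⟩ := hh.ne_of_eq_one e
  have h1 : ∀ σ, 𝔼 ε ∈ signVectors V, tripleValue h L t s σ ε u v w =
      (1 / 3 + σ u / 12) * (1 / 3 + σ v / 12) * (1 / 3 - σ w / 6) - s ^ 2 *
      ((∑ a, correlationMatrix h L t σ u a * correlationMatrix h L t σ v a) *
        (1 / 3 - σ w / 6)) := by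
    intro σ
    have h2 : ∀ ε, tripleValue h L t s σ ε u v w =
        (1 / 3 + σ u / 12) * (1 / 3 + σ v / 12) * (1 / 3 - σ w / 6) +
        (1 / 3 + σ v / 12) * (1 / 3 - σ w / 6) * s * perturbation h L t σ ε u -
        (1 / 3 + σ u / 12) * (1 / 3 - σ w / 6) * s * perturbation h L t σ ε v -
        s ^ 2 * (1 / 3 - σ w / 6) *
          (perturbation h L t σ ε u * perturbation h L t σ ε v) := by
      intro ε
      simp only [tripleValue]
      ring
    have h3 : ∀ u, 𝔼 ε ∈ signVectors V, perturbation h L t σ ε u = 0 :=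
      fun u => expect_signVectors_linear _
    simp only [h2, Finset.expect_add_distrib, Finset.expect_sub_distrib, ← Finset.mul_expect,
      expect_perturbation_mul, h3, Finset.expect_const signVectors_nonempty]
    ring
  simp only [h1, Finset.expect_sub_distrib, ← Finset.mul_expect]
  rw [expect_prod_signs huv hvw huw, expect_sum_correlationMatrix_mul L t hh e]
  split_ifs <;> ring

end Tensor

section Rounding

variable {V : Type*} [Fintype V] [DecidableEq V] {h : V → V → V → ℝ}

/-! ### Vertices of low degree -/

/-- The weight of the ordered edges whose first two vertices satisfy `f`. -/
noncomputable def edgeSum (h : V → V → V → ℝ) (f : V → V → ℝ) : ℝ :=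
  ∑ u, ∑ v, ∑ w, h u v w * f u v

lemma edgeSum_rotate (hh : IsLinearTensor h) (f : V → V → ℝ) :
    ∑ u, ∑ v, ∑ w, h u v w * f v w = edgeSum h f := by
  rw [edgeSum, Finset.sum_comm]
  refine Finset.sum_congr rfl fun v _ => ?_
  rw [Finset.sum_comm]
  refine Finset.sum_congr rfl fun w _ => Finset.sum_congr rfl fun u _ => ?_
  rw [← hh.swap_left, ← hh.swap_right]

lemma edgeSum_rotate' (hh : IsLinearTensor h) (f : V → V → ℝ) :
    ∑ u, ∑ v, ∑ w, h u v w * f w u = edgeSum h f := by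
  rw [edgeSum, Finset.sum_comm (f := fun w u => ∑ v, h w u v * f w u)]
  refine Finset.sum_congr rfl fun u _ => ?_
  rw [Finset.sum_comm]
  refine Finset.sum_congr rfl fun w _ => Finset.sum_congr rfl fun v _ => ?_
  rw [← hh.swap_right, ← hh.swap_left]

lemma one_le_orderedDegree (hh : IsLinearTensor h) {u v w : V} (e : h u v w = 1) :
    1 ≤ orderedDegree h u := by
  rw [← e]
  refine (Finset.single_le_sum (f := fun w => h u v w) (fun w _ => hh.nonneg u v w)
    (Finset.mem_univ w)).trans ?_
  exact Finset.single_le_sum (f := fun v => ∑ w, h u v w)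
    (fun v _ => Finset.sum_nonneg fun w _ => hh.nonneg u v w) (Finset.mem_univ v)

lemma orderedDegree_nonneg (hh : IsLinearTensor h) (u : V) : 0 ≤ orderedDegree h u :=
  Finset.sum_nonneg fun v _ => Finset.sum_nonneg fun w _ => hh.nonneg u v w

lemma card_mul_le_of_le_orderedDegree (hh : IsLinearTensor h) {m d : ℝ}
    (hm : ∑ u, ∑ v, ∑ w, h u v w = 6 * m) (s : Finset V) (hs : ∀ u ∈ s, d ≤ orderedDegree h u) :
    s.card * d ≤ 6 * m := by
  rw [← hm]
  calc (s.card : ℝ) * d = ∑ u ∈ s, d := by simp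
    _ ≤ ∑ u ∈ s, orderedDegree h u := Finset.sum_le_sum hs
    _ ≤ ∑ u, orderedDegree h u :=
      Finset.sum_le_univ_sum_of_nonneg fun u => orderedDegree_nonneg hh u

/-- The non-isolated vertices of ordered degree at most `D`. -/
noncomputable def lowVertices (h : V → V → V → ℝ) (D : ℝ) : Finset V :=
  Finset.univ.filter fun u => 1 ≤ orderedDegree h u ∧ orderedDegree h u ≤ D

/-- In a linear 3-graph with `m` edges there are at most `√m` vertices of ordered degree above
`6 √m`, so that at most `m / 2` edges contain two of them. -/
lemma le_edgeSum_lowVertices (hh : IsLinearTensor h) {m D : ℝ} (hD : 0 < D)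
    (hDm : D ^ 2 = 36 * m) (hm : ∑ u, ∑ v, ∑ w, h u v w = 6 * m) :
    m ≤ edgeSum h fun u v => if u ∈ lowVertices h D ∧ v ∈ lowVertices h D then 1 else 0 := by
  set H : Finset V := Finset.univ.filter fun u => D < orderedDegree h u with hH
  set fL : V → V → ℝ := fun u v => if u ∈ lowVertices h D ∧ v ∈ lowVertices h D then 1 else 0
    with hfL
  set fH : V → V → ℝ := fun u v => if u ∈ H ∧ v ∈ H then 1 else 0 with hfH
  have hcard : (H.card : ℝ) * D ≤ 6 * m :=
    card_mul_le_of_le_orderedDegree hh hm H fun u hu => (Finset.mem_filter.1 hu).2.le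
  have hHH : edgeSum h fH ≤ m := by
    have h1 : edgeSum h fH ≤ ∑ u, ∑ v, fH u v := by
      refine Finset.sum_le_sum fun u _ => Finset.sum_le_sum fun v _ => ?_
      rw [← Finset.sum_mul]
      refine mul_le_of_le_one_left ?_ (hh.sum_le_one u v)
      simp only [hfH]
      split_ifs <;> norm_num
    have h2 : ∑ u, ∑ v, fH u v = (H.card : ℝ) ^ 2 := by
      simp only [hfH, ite_and]
      simp [sq]
    have h3 : ((H.card : ℝ) * D) ^ 2 ≤ (6 * m) ^ 2 := pow_le_pow_left₀ (by positivity) hcard 2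
    rw [mul_pow, hDm] at h3
    have hmpos : 0 < m := by nlinarith [pow_pos hD 2]
    have h4 : (H.card : ℝ) ^ 2 ≤ m := by
      by_contra! hlt
      nlinarith
    linarith
  -- For an edge with `k = 0, 1, 2, 3` vertices in `H`, the left side is `1, 1, 0, -2` and the right
  -- side is `3, 1, 0, 0`.
  have hpt : ∀ u v w, h u v w - (h u v w * fH u v + h u v w * fH v w + h u v w * fH w u) ≤
      h u v w * fL u v + h u v w * fL v w + h u v w * fL w u := by
    intro u v w
    rcases hh.zero_or_one u v w with e | e
    · simp [e]
    have e1 := one_le_orderedDegree hh e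
    have e2 := one_le_orderedDegree hh ((hh.swap_left u v w).trans e)
    have e3 := one_le_orderedDegree hh
      ((hh.swap_left u w v).trans ((hh.swap_right u v w).trans e))
    simp only [e, hfL, hfH, hH, lowVertices, Finset.mem_filter, Finset.mem_univ, true_and,
      ← not_lt (a := D)]
    by_cases c1 : D < orderedDegree h u <;> by_cases c2 : D < orderedDegree h v <;>
      by_cases c3 : D < orderedDegree h w <;> simp [c1, c2, c3, e1, e2, e3]
  have hsum := Finset.sum_le_sum fun u (_ : u ∈ Finset.univ) =>
    Finset.sum_le_sum fun v (_ : v ∈ Finset.univ) =>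
      Finset.sum_le_sum fun w (_ : w ∈ Finset.univ) => hpt u v w
  simp only [Finset.sum_add_distrib, Finset.sum_sub_distrib, edgeSum_rotate hh,
    edgeSum_rotate' hh] at hsum
  rw [hm] at hsum
  have r1 : ∀ f, ∑ u, ∑ v, ∑ w, h u v w * f u v = edgeSum h f := fun _ => rfl
  simp only [r1] at hsum
  linarith

/-! ### Choosing the signs -/

/-- The expected number of ordered edges that receive the colours `0, 1, 2` in this order. -/
noncomputable def fractionalCut (h : V → V → V → ℝ) (p : V → Fin 3 → ℝ) : ℝ :=
  ∑ u, ∑ v, ∑ w, h u v w * (p u 0 * p v 1 * p w 2)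

/-- The fractional colouring determined by the signs `σ` and the perturbation. -/
noncomputable def signedColouring (h : V → V → V → ℝ) (L : Finset V) (t s : ℝ) (σ ε : V → ℝ)
    (v : V) : Fin 3 → ℝ :=
  ![1 / 3 + σ v / 12 + s * perturbation h L t σ ε v,
    1 / 3 + σ v / 12 - s * perturbation h L t σ ε v, 1 / 3 - σ v / 6]

lemma expect_fractionalCut (hh : IsLinearTensor h) (L : Finset V) (t s : ℝ) :
    𝔼 σ ∈ signVectors V, 𝔼 ε ∈ signVectors V, fractionalCut h (signedColouring h L t s σ ε) =
      (∑ u, ∑ v, ∑ w, h u v w) / 27 +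
        s ^ 2 * t / 3 * edgeSum h fun u v => if u ∈ L ∧ v ∈ L then 1 else 0 := by
  have h1 : ∀ σ ε, fractionalCut h (signedColouring h L t s σ ε) =
      ∑ u, ∑ v, ∑ w, h u v w * tripleValue h L t s σ ε u v w := fun σ ε => rfl
  simp only [h1, Finset.expect_sum_comm, ← Finset.mul_expect, edgeSum, Finset.mul_sum,
    Finset.sum_div, ← Finset.sum_add_distrib]
  refine Finset.sum_congr rfl fun u _ => Finset.sum_congr rfl fun v _ =>
    Finset.sum_congr rfl fun w _ => ?_
  rcases hh.zero_or_one u v w with e | e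
  · simp [e]
  · rw [expect_tripleValue L t s hh e, e]
    split_ifs <;> ring

/-- Signs for which the fractional cut is almost as large as its mean and for which all
perturbations are below `τ`. The exponential penalty in the proof exceeds `M` as soon as one
perturbation reaches `τ`, so that a choice with large penalized value has no such perturbation. -/
lemma exists_signs (hh : IsLinearTensor h) (L : Finset V) {t s τ M : ℝ}
    (hL : ∀ u ∈ L, t ^ 2 * orderedDegree h u ≤ 1) (hτ : 0 < τ)
    (hM : ∀ σ ∈ signVectors V, ∀ ε ∈ signVectors V,
      fractionalCut h (signedColouring h L t s σ ε) ≤ M) (hM0 : 0 < M) {a : ℝ} (ha : 0 < a)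
    (hmean : a < (∑ u, ∑ v, ∑ w, h u v w) / 27 +
        s ^ 2 * t / 3 * (edgeSum h fun u v => if u ∈ L ∧ v ∈ L then 1 else 0) -
        2 * M * L.card * Real.exp (-(τ ^ 2 / 4))) :
    ∃ σ ∈ signVectors V, ∃ ε ∈ signVectors V,
      (∀ u ∈ L, |perturbation h L t σ ε u| ≤ τ) ∧
      a ≤ fractionalCut h (signedColouring h L t s σ ε) := by
  set pen : (V → ℝ) → (V → ℝ) → ℝ := fun σ ε =>
    ∑ u ∈ L, (Real.exp (τ / 2 * perturbation h L t σ ε u) +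
      Real.exp (-(τ / 2) * perturbation h L t σ ε u)) with hpen
  have hpenE : ∀ σ ∈ signVectors V,
      𝔼 ε ∈ signVectors V, pen σ ε ≤ 2 * L.card * Real.exp (τ ^ 2 / 4) := by
    intro σ hσ
    simp only [hpen, Finset.expect_sum_comm, Finset.expect_add_distrib]
    calc _ ≤ ∑ u ∈ L, (Real.exp ((τ / 2) ^ 2) + Real.exp ((-(τ / 2)) ^ 2)) :=
          Finset.sum_le_sum fun u hu => add_le_add
            (expect_exp_perturbation_le L t hh hσ hu (hL u hu) _)
            (expect_exp_perturbation_le L t hh hσ hu (hL u hu) _)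
      _ = 2 * L.card * Real.exp (τ ^ 2 / 4) := by
          rw [neg_sq, div_pow]
          norm_num
          ring
  have hexp : Real.exp (-(τ ^ 2 / 2)) * Real.exp (τ ^ 2 / 4) = Real.exp (-(τ ^ 2 / 4)) := by
    rw [← Real.exp_add]
    ring_nf
  have hE : a < 𝔼 σ ∈ signVectors V, 𝔼 ε ∈ signVectors V,
      (fractionalCut h (signedColouring h L t s σ ε) -
        M * Real.exp (-(τ ^ 2 / 2)) * pen σ ε) := by
    simp only [Finset.expect_sub_distrib, ← Finset.mul_expect, expect_fractionalCut hh]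
    have h1 : 𝔼 σ ∈ signVectors V, 𝔼 ε ∈ signVectors V, pen σ ε ≤
        2 * L.card * Real.exp (τ ^ 2 / 4) :=
      Finset.expect_le signVectors_nonempty hpenE
    have h2 := mul_le_mul_of_nonneg_left h1 (by positivity : 0 ≤ M * Real.exp (-(τ ^ 2 / 2)))
    have h3 : M * Real.exp (-(τ ^ 2 / 2)) * (2 * L.card * Real.exp (τ ^ 2 / 4)) =
        2 * M * L.card * Real.exp (-(τ ^ 2 / 4)) := by
      rw [← hexp]; ring
    linarith
  obtain ⟨σ, hσ, hE⟩ := Finset.exists_lt_of_lt_expect signVectors_nonempty hE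
  obtain ⟨ε, hε, hE⟩ := Finset.exists_lt_of_lt_expect signVectors_nonempty hE
  have hpen0 : 0 ≤ pen σ ε := Finset.sum_nonneg fun u _ => by positivity
  refine ⟨σ, hσ, ε, hε, ?_, ?_⟩
  · intro u hu
    by_contra! hlt
    have h1 : Real.exp (τ ^ 2 / 2) ≤ pen σ ε := by
      refine le_trans ?_ (Finset.single_le_sum (f := fun u =>
        Real.exp (τ / 2 * perturbation h L t σ ε u) +
        Real.exp (-(τ / 2) * perturbation h L t σ ε u)) (fun u _ => by positivity) hu)
      rcases lt_abs.1 hlt with h | h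
      · refine le_trans (Real.exp_le_exp.2 ?_) (le_add_of_nonneg_right (Real.exp_nonneg _))
        nlinarith
      · refine le_trans (Real.exp_le_exp.2 ?_) (le_add_of_nonneg_left (Real.exp_nonneg _))
        nlinarith
    have h2 := mul_le_mul_of_nonneg_left h1 (by positivity : 0 ≤ M * Real.exp (-(τ ^ 2 / 2)))
    rw [mul_assoc, ← Real.exp_add, neg_add_cancel, Real.exp_zero] at h2
    have := hM σ hσ ε hε
    linarith
  · have : 0 ≤ M * Real.exp (-(τ ^ 2 / 2)) * pen σ ε := by positivity
    linarith

/-! ### From fractional colourings to colourings -/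

/-- Some colouring does at least as well as independent random colours with distributions `p`. -/
lemma exists_colouring (hh : IsLinearTensor h) (p : V → Fin 3 → ℝ) (hp : ∀ v i, 0 ≤ p v i)
    (hp1 : ∀ v, ∑ i, p v i = 1) :
    ∃ f : V → Fin 3, fractionalCut h p ≤
      ∑ u, ∑ v, ∑ w, h u v w * if f u = 0 ∧ f v = 1 ∧ f w = 2 then 1 else 0 := by
  have hprod : ∀ g : V → Fin 3 → ℝ, ∑ f : V → Fin 3, ∏ x, g x (f x) = ∏ x, ∑ i, g x i := by
    intro g
    rw [Finset.prod_univ_sum, Fintype.piFinset_univ]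
  have hmarg : ∀ u v w, u ≠ v → v ≠ w → u ≠ w →
      ∑ f : V → Fin 3, (∏ x, p x (f x)) * (if f u = 0 ∧ f v = 1 ∧ f w = 2 then 1 else 0) =
        p u 0 * p v 1 * p w 2 := by
    intro u v w huv hvw huw
    have h1 := hprod fun x i => p x i * ((if u = x then if i = 0 then 1 else 0 else 1) *
      (if v = x then if i = 1 then 1 else 0 else 1) *
      (if w = x then if i = 2 then 1 else 0 else 1))
    have h2 : ∀ x, ∑ i, p x i * ((if u = x then if i = 0 then 1 else 0 else 1) *
        (if v = x then if i = 1 then 1 else 0 else 1) *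
        (if w = x then if i = 2 then 1 else 0 else 1)) =
        (if u = x then p x 0 else 1) * (if v = x then p x 1 else 1) *
          (if w = x then p x 2 else 1) := by
      intro x
      by_cases c1 : u = x
      · subst c1; simp [huv.symm, huw.symm]
      by_cases c2 : v = x
      · subst c2; simp [c1, hvw.symm]
      by_cases c3 : w = x
      · subst c3; simp [c1, c2]
      · simp [c1, c2, c3, hp1]
    simp only [h2, Finset.prod_mul_distrib, Finset.prod_ite_eq, Finset.mem_univ, if_true] at h1
    rw [← h1]
    refine Finset.sum_congr rfl fun f _ => ?_
    congr 1
    by_cases c1 : f u = 0 <;> by_cases c2 : f v = 1 <;> by_cases c3 : f w = 2 <;> simp [c1, c2, c3]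
  have htotal : ∑ f : V → Fin 3, ∏ x, p x (f x) = 1 := by
    rw [hprod]; simp [hp1]
  by_contra! hlt
  have h1 : ∑ f : V → Fin 3, (∏ x, p x (f x)) *
      (∑ u, ∑ v, ∑ w, h u v w * if f u = 0 ∧ f v = 1 ∧ f w = 2 then 1 else 0) =
      fractionalCut h p := by
    simp only [Finset.mul_sum]
    rw [Finset.sum_comm]
    refine Finset.sum_congr rfl fun u _ => ?_
    rw [Finset.sum_comm]
    refine Finset.sum_congr rfl fun v _ => ?_
    rw [Finset.sum_comm]
    refine Finset.sum_congr rfl fun w _ => ?_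
    rcases hh.zero_or_one u v w with e | e
    · simp [e]
    · obtain ⟨huv, hvw, huw⟩ := hh.ne_of_eq_one e
      rw [← hmarg u v w huv hvw huw, e, one_mul]
      simp
  have h2 : ∑ f : V → Fin 3, (∏ x, p x (f x)) *
      (∑ u, ∑ v, ∑ w, h u v w * if f u = 0 ∧ f v = 1 ∧ f w = 2 then 1 else 0) <
      ∑ f : V → Fin 3, (∏ x, p x (f x)) * fractionalCut h p := by
    have hnn : ∀ f : V → Fin 3, 0 ≤ ∏ x, p x (f x) := fun f =>
      Finset.prod_nonneg fun x _ => hp x _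
    obtain ⟨f, hf⟩ : ∃ f : V → Fin 3, 0 < ∏ x, p x (f x) := by
      by_contra! hle
      have := Finset.sum_nonpos fun f (_ : f ∈ Finset.univ) => hle f
      linarith
    refine Finset.sum_lt_sum (fun f _ => mul_le_mul_of_nonneg_left (hlt f).le (hnn f))
      ⟨f, Finset.mem_univ f, mul_lt_mul_of_pos_left (hlt f) hf⟩
  rw [h1, ← Finset.sum_mul, htotal, one_mul] at h2
  exact lt_irrefl _ h2

end Rounding

section LargeCut

variable {V : Type*} [Fintype V] [DecidableEq V] {h : V → V → V → ℝ}

/-! ### Large cuts of linear 3-graphs -/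

/-- A crude bound for the fractional cut that holds for all signs. -/
lemma fractionalCut_signedColouring_le (hh : IsLinearTensor h) {L : Finset V} {t s m : ℝ}
    (ht : 0 ≤ t) (hs : 0 ≤ s) (hs1 : s ≤ 1) (hm1 : 1 ≤ m)
    (hm : ∑ u, ∑ v, ∑ w, h u v w = 6 * m) (hL : ∀ u ∈ L, t * orderedDegree h u ≤ 2 * m)
    {σ ε : V → ℝ} (hσ : σ ∈ signVectors V) (hε : ε ∈ signVectors V) :
    fractionalCut h (signedColouring h L t s σ ε) ≤ 48 * m ^ 3 := by
  have hx : ∀ u, |s * perturbation h L t σ ε u| ≤ 3 * m := by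
    intro u
    rw [abs_mul, abs_of_nonneg hs]
    have h1 : |perturbation h L t σ ε u| ≤ 3 * m := by
      by_cases hu : u ∈ L
      · have := abs_perturbation_le L t hh ht hσ hε hu
        have := hL u hu
        linarith
      · rw [perturbation_of_notMem L t σ ε hu, abs_zero]
        linarith
    nlinarith [abs_nonneg (perturbation h L t σ ε u)]
  have hs3 : ∀ u, -1 ≤ σ u ∧ σ u ≤ 1 := fun u =>
    abs_le.1 (abs_eq_one_of_mem_signVectors hσ u).le
  have hpt : ∀ u v w, signedColouring h L t s σ ε u 0 * signedColouring h L t s σ ε v 1 *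
      signedColouring h L t s σ ε w 2 ≤ 8 * m ^ 2 := by
    intro u v w
    have h0 : |signedColouring h L t s σ ε u 0| ≤ 4 * m := by
      have := abs_le.1 (hx u)
      have := hs3 u
      simp only [signedColouring, Matrix.cons_val_zero]
      rw [abs_le]
      constructor <;> linarith
    have h1 : |signedColouring h L t s σ ε v 1| ≤ 4 * m := by
      have := abs_le.1 (hx v)
      have := hs3 v
      simp only [signedColouring, Matrix.cons_val_one, Matrix.cons_val_zero]
      rw [abs_le]
      constructor <;> linarith
    have h2 : |signedColouring h L t s σ ε w 2| ≤ 1 / 2 := by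
      have := hs3 w
      simp only [signedColouring, Matrix.cons_val]
      rw [abs_le]
      constructor <;> linarith
    calc _ ≤ |signedColouring h L t s σ ε u 0 * signedColouring h L t s σ ε v 1 *
          signedColouring h L t s σ ε w 2| := le_abs_self _
      _ ≤ (4 * m) * (4 * m) * (1 / 2) := by
        rw [abs_mul, abs_mul]
        gcongr
      _ = 8 * m ^ 2 := by ring
  calc fractionalCut h (signedColouring h L t s σ ε) ≤
        ∑ u, ∑ v, ∑ w, h u v w * (8 * m ^ 2) :=
      Finset.sum_le_sum fun u _ => Finset.sum_le_sum fun v _ => Finset.sum_le_sum fun w _ =>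
        mul_le_mul_of_nonneg_left (hpt u v w) (hh.nonneg u v w)
    _ = 48 * m ^ 3 := by
      simp only [← Finset.sum_mul, hm]
      ring

/-- For `m = q ^ 4` edges, low degrees are those up to `6 q ^ 2`, and the parameters of the
fractional colouring are `t = 1 / (3 q)` and `s = 1 / (4 τ)` with `τ ^ 2 = 160 log m`. -/
lemma exists_fractional_colouring (hh : IsLinearTensor h) {q m : ℝ} (hq : 0 < q)
    (hqm : q ^ 4 = m) (hm2 : 2 ≤ m) (hm : ∑ u, ∑ v, ∑ w, h u v w = 6 * m) :
    ∃ p : V → Fin 3 → ℝ, (∀ v i, 0 ≤ p v i) ∧ (∀ v, ∑ i, p v i = 1) ∧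
      2 / 9 * m + q ^ 3 / (46080 * Real.log m) ≤ fractionalCut h p := by
  have hq1 : 1 ≤ q := by
    by_contra! hlt
    have := pow_le_one₀ hq.le hlt.le (n := 4)
    linarith
  set L := lowVertices h (6 * q ^ 2) with hL
  have hlog : 1 / 2 ≤ Real.log m :=
    (by linarith [Real.log_two_gt_d9] : (1 : ℝ) / 2 ≤ Real.log 2).trans
      (Real.log_le_log (by norm_num) hm2)
  have hlogm : Real.log m ≤ m := (Real.log_le_sub_one_of_pos (by linarith)).trans (by linarith)
  obtain ⟨τ, hτ, hτ2⟩ : ∃ τ : ℝ, 0 < τ ∧ τ ^ 2 = 160 * Real.log m :=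
    ⟨√(160 * Real.log m), Real.sqrt_pos.2 (by linarith), Real.sq_sqrt (by linarith)⟩
  have hτ1 : 1 ≤ τ := by nlinarith
  have hdeg : ∀ u ∈ L, orderedDegree h u ≤ 6 * q ^ 2 := fun u hu =>
    (Finset.mem_filter.1 hu).2.2
  have hcard : (L.card : ℝ) ≤ 6 * m := by
    have := card_mul_le_of_le_orderedDegree hh hm L fun u hu => (Finset.mem_filter.1 hu).2.1
    linarith
  have hedge := le_edgeSum_lowVertices hh (D := 6 * q ^ 2) (by positivity)
    (by rw [← hqm]; ring) hm
  rw [← hL] at hedge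
  set t : ℝ := 1 / (3 * q) with ht
  set s : ℝ := 1 / (4 * τ) with hs
  have ht0 : 0 < t := by positivity
  have hs0 : 0 < s := by positivity
  have hs1 : s ≤ 1 := by
    rw [hs, div_le_one (by positivity)]
    linarith
  have htq : t * (6 * q ^ 2) = 2 * q := by rw [ht]; field_simp; norm_num
  have ht2 : t ^ 2 * (6 * q ^ 2) ≤ 1 := by
    rw [ht]; field_simp; norm_num
  have hqle : q ≤ m := by
    rw [← hqm]
    exact le_self_pow₀ hq1 (by norm_num)
  have hgain : s ^ 2 * t / 3 * m = 2 * (q ^ 3 / (46080 * Real.log m)) := by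
    rw [hs, ht, div_pow, mul_pow, hτ2, ← hqm]
    have : Real.log (q ^ 4) ≠ 0 := by rw [hqm]; linarith
    field_simp
    norm_num
  -- The penalty is at most `m ^ (-36)` up to a constant, since `exp (-τ ^ 2 / 4) = m ^ (-40)`.
  have hpen : 2 * (48 * m ^ 3) * L.card * Real.exp (-(τ ^ 2 / 4)) <
      q ^ 3 / (46080 * Real.log m) := by
    have h1 : Real.exp (-(τ ^ 2 / 4)) = (m ^ 40)⁻¹ := by
      rw [hτ2, Real.exp_neg]
      congr 1
      rw [← Real.exp_log (by positivity : 0 < m ^ 40), Real.log_pow]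
      congr 1
      push_cast
      ring
    rw [h1, ← div_eq_mul_inv, div_lt_div_iff₀ (by positivity) (by positivity)]
    have h2 : (2 : ℝ) ^ 35 ≤ m ^ 35 := pow_le_pow_left₀ (by norm_num) hm2 35
    have hm0 : 0 < m := by linarith
    calc 2 * (48 * m ^ 3) * L.card * (46080 * Real.log m) ≤
          2 * (48 * m ^ 3) * (6 * m) * (46080 * m) := by gcongr
      _ = m ^ 5 * 26542080 := by ring
      _ < m ^ 5 * m ^ 35 := by
        refine mul_lt_mul_of_pos_left (lt_of_lt_of_le ?_ h2) (by positivity)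
        norm_num
      _ = 1 * m ^ 40 := by ring
      _ ≤ q ^ 3 * m ^ 40 := by
        gcongr
        exact one_le_pow₀ hq1
  have hmain : 2 / 9 * m + q ^ 3 / (46080 * Real.log m) < (∑ u, ∑ v, ∑ w, h u v w) / 27 +
      s ^ 2 * t / 3 * (edgeSum h fun u v => if u ∈ L ∧ v ∈ L then 1 else 0) -
        2 * (48 * m ^ 3) * L.card * Real.exp (-(τ ^ 2 / 4)) := by
    have h1 := mul_le_mul_of_nonneg_left hedge (by positivity : 0 ≤ s ^ 2 * t / 3)
    rw [hm]
    linarith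
  have hpos : 0 < 2 / 9 * m + q ^ 3 / (46080 * Real.log m) := by positivity
  obtain ⟨σ, hσ, ε, -, hτb, hcut⟩ := exists_signs hh L
    (fun u hu => (mul_le_mul_of_nonneg_left (hdeg u hu) (sq_nonneg t)).trans ht2) hτ
    (fun σ hσ ε hε => fractionalCut_signedColouring_le hh ht0.le hs0.le hs1 (by linarith) hm
      (fun u hu => (mul_le_mul_of_nonneg_left (hdeg u hu) ht0.le).trans (by linarith)) hσ hε)
    (by positivity) hpos hmain
  refine ⟨_, fun v i => ?_, fun v => ?_, hcut⟩
  · have h1 : |s * perturbation h L t σ ε v| ≤ 1 / 4 := by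
      rw [abs_mul, abs_of_pos hs0]
      have h2 : |perturbation h L t σ ε v| ≤ τ := by
        by_cases hv : v ∈ L
        · exact hτb v hv
        · rw [perturbation_of_notMem L t σ ε hv, abs_zero]
          exact hτ.le
      calc s * |perturbation h L t σ ε v| ≤ s * τ := by gcongr
        _ = 1 / 4 := by rw [hs]; field_simp
    have h2 := abs_le.1 h1
    have h3 := abs_le.1 (abs_eq_one_of_mem_signVectors hσ v).le
    fin_cases i <;> simp [signedColouring] <;> linarith
  · simp [signedColouring, Fin.sum_univ_three]
    ring

end LargeCut

/-! ### The tensor of a linear 3-graph and its cuts -/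

namespace Hypergraph

variable {α : Type*} (H : Hypergraph α)

open Classical in
/-- The indicator function of the ordered edges of `H`. -/
noncomputable def edgeTensor (u v w : H.vertexSet) : ℝ :=
  if ({(u : α), (v : α), (w : α)} : Set α) ∈ H.edgeSet then 1 else 0

variable {H}

lemma IsUniform.ne_of_mem (hu : H.IsUniform 3) {a b c : α}
    (he : ({a, b, c} : Set α) ∈ H.edgeSet) : a ≠ b ∧ b ≠ c ∧ a ≠ c := by
  have h2 : ∀ x y : α, ({x, y} : Set α).encard ≠ 3 := fun x y e => by
    have := Set.encard_insert_le {y} x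
    rw [e, Set.encard_singleton] at this
    exact absurd this (by norm_num)
  have h3 := hu _ he
  refine ⟨?_, ?_, ?_⟩
  · rintro rfl
    rw [Set.insert_eq_of_mem (by simp)] at h3
    exact h2 _ _ h3
  · rintro rfl
    simp only [Set.pair_eq_singleton] at h3
    exact h2 _ _ h3
  · rintro rfl
    rw [Set.insert_eq_of_mem (by simp)] at h3
    exact h2 _ _ h3

lemma edgeTensor_isLinearTensor (hu : H.IsUniform 3) (hl : H.IsLinear) :
    IsLinearTensor H.edgeTensor where
  zero_or_one u v w := by
    unfold edgeTensor
    split_ifs <;> simp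
  swap_left u v w := by
    unfold edgeTensor
    rw [Set.insert_comm]
  swap_right u v w := by
    unfold edgeTensor
    rw [Set.pair_comm]
  diag u w := by
    unfold edgeTensor
    rw [if_neg fun he => (hu.ne_of_mem he).1 rfl]
  unique u v w w' e e' := by
    have he : ({(u : α), (v : α), (w : α)} : Set α) ∈ H.edgeSet := by
      by_contra hne
      simp [edgeTensor, hne] at e
    have he' : ({(u : α), (v : α), (w' : α)} : Set α) ∈ H.edgeSet := by
      by_contra hne
      simp [edgeTensor, hne] at e'
    obtain ⟨huv, hvw, huw⟩ := hu.ne_of_mem he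
    by_contra hne
    have hne' : (w : α) ≠ w' := fun h => hne (Subtype.ext h)
    have hset : ({(u : α), (v : α), (w : α)} : Set α) ≠ {(u : α), (v : α), (w' : α)} := by
      intro heq
      have : (w : α) ∈ ({(u : α), (v : α), (w' : α)} : Set α) := by
        rw [← heq]; simp
      simp [huw.symm, hvw.symm, hne'] at this
    have h1 := hl _ he _ he' hset
    have h2 : ({(u : α), (v : α)} : Set α) ⊆
        {(u : α), (v : α), (w : α)} ∩ {(u : α), (v : α), (w' : α)} := by
      rintro x (rfl | rfl) <;> simp
    have h3 := (Set.encard_le_encard h2).trans h1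
    rw [Set.encard_pair huv] at h3
    exact absurd h3 (by norm_num)

lemma IsUniform.exists_eq (hu : H.IsUniform 3) {e : Set α} (he : e ∈ H.edgeSet) :
    ∃ a b c : H.vertexSet, a ≠ b ∧ b ≠ c ∧ a ≠ c ∧ e = {(a : α), (b : α), (c : α)} := by
  obtain ⟨a, b, c, hab, hac, hbc, rfl⟩ := Set.encard_eq_three.1 (hu e he)
  have hs := H.subset_vertexSet_of_mem_edgeSet' he
  exact ⟨⟨a, hs (by simp)⟩, ⟨b, hs (by simp)⟩, ⟨c, hs (by simp)⟩, by simpa using hab,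
    by simpa using hbc, by simpa using hac, rfl⟩

open Classical in
/-- Every edge has six orderings. -/
lemma sum_edgeTensor [Fintype H.vertexSet] (hu : H.IsUniform 3) :
    ∑ u, ∑ v, ∑ w, H.edgeTensor u v w = 6 * H.numEdges := by
  have hfin : H.edgeSet.Finite :=
    (Set.toFinite H.vertexSet).finite_subsets.subset fun e he =>
      H.subset_vertexSet_of_mem_edgeSet' he
  set toEdge : H.vertexSet × H.vertexSet × H.vertexSet → Set α :=
    fun x => {(x.1 : α), (x.2.1 : α), (x.2.2 : α)} with htoEdge
  set T : Finset (H.vertexSet × H.vertexSet × H.vertexSet) :=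
    Finset.univ.filter fun x => toEdge x ∈ H.edgeSet with hT
  have h1 : ∑ u, ∑ v, ∑ w, H.edgeTensor u v w = T.card := by
    rw [hT, Finset.card_filter]
    push_cast
    simp only [Fintype.sum_prod_type, edgeTensor, htoEdge]
  have h2 : T.card = hfin.toFinset.card * 6 := by
    rw [Finset.card_eq_sum_card_fiberwise (f := toEdge) (t := hfin.toFinset)
      fun x hx => by simpa [hT] using hx]
    refine Finset.sum_const_nat fun e he => ?_
    have he' : e ∈ H.edgeSet := by simpa using he
    obtain ⟨a, b, c, hab, hbc, hac, rfl⟩ := hu.exists_eq he'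
    have h3 : T.filter (fun x => toEdge x = {(a : α), (b : α), (c : α)}) =
        {(a, b, c), (a, c, b), (b, a, c), (b, c, a), (c, a, b), (c, b, a)} := by
      ext ⟨u, v, w⟩
      simp only [hT, htoEdge, Finset.mem_filter, Finset.mem_univ, true_and, Finset.mem_insert,
        Finset.mem_singleton, Prod.mk.injEq]
      constructor
      · rintro ⟨hm, heq⟩
        obtain ⟨huv, hvw, huw⟩ := hu.ne_of_mem hm
        have hmem : ∀ x : H.vertexSet, (x : α) ∈ ({(u : α), (v : α), (w : α)} : Set α) →
            x = a ∨ x = b ∨ x = c := by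
          intro x hx
          rw [heq] at hx
          simpa [Subtype.ext_iff] using hx
        have hu' := hmem u (by simp)
        have hv' := hmem v (by simp)
        have hw' := hmem w (by simp)
        rw [Ne, ← Subtype.ext_iff] at huv hvw huw
        grind
      · intro hperm
        have heq : ({(u : α), (v : α), (w : α)} : Set α) = {(a : α), (b : α), (c : α)} := by
          rcases hperm with ⟨rfl, rfl, rfl⟩ | ⟨rfl, rfl, rfl⟩ | ⟨rfl, rfl, rfl⟩ | ⟨rfl, rfl, rfl⟩ |
            ⟨rfl, rfl, rfl⟩ | ⟨rfl, rfl, rfl⟩ <;>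
          · refine Set.ext fun x => ?_
            change (x = _ ∨ x = _ ∨ x = _) ↔ (x = _ ∨ x = _ ∨ x = _)
            tauto
        exact ⟨heq ▸ he', heq⟩
    rw [h3]
    simp [hab, hbc, hac, hab.symm, hbc.symm, hac.symm]
  rw [h1, h2, numEdges, Set.ncard_eq_toFinset_card _ hfin]
  push_cast
  ring

/-- The parts of the vertex partition given by a colouring. -/
def colourClass {k : ℕ} (f : H.vertexSet → Fin k) (i : Fin k) : Set α :=
  {x | ∃ y : H.vertexSet, f y = i ∧ (y : α) = x}

lemma isVertexPartition_colourClass {k : ℕ} (f : H.vertexSet → Fin k) :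
    H.IsVertexPartition (colourClass f) := by
  refine ⟨fun i j hij => Set.disjoint_left.2 ?_, ?_⟩
  · rintro _ ⟨x, hx, rfl⟩ ⟨y, hy, hxy⟩
    obtain rfl := Subtype.ext hxy
    exact hij (hx.symm.trans hy)
  · ext x
    simp only [Set.mem_iUnion]
    constructor
    · rintro ⟨i, y, -, rfl⟩
      exact y.2
    · exact fun hx => ⟨f ⟨x, hx⟩, ⟨x, hx⟩, rfl, rfl⟩

open Classical in
/-- An edge of the cut is counted by at most one of its orderings. -/
lemma sum_edgeTensor_le_cutSize [Fintype H.vertexSet] (f : H.vertexSet → Fin 3) :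
    ∑ u, ∑ v, ∑ w, H.edgeTensor u v w * (if f u = 0 ∧ f v = 1 ∧ f w = 2 then 1 else 0) ≤
      (H.cutSize (colourClass f) : ℝ) := by
  have hfin : {e ∈ H.edgeSet | ∀ i, (e ∩ colourClass f i).Nonempty}.Finite :=
    ((Set.toFinite H.vertexSet).finite_subsets.subset fun e he =>
      H.subset_vertexSet_of_mem_edgeSet' he).subset (Set.sep_subset _ _)
  set toEdge : H.vertexSet × H.vertexSet × H.vertexSet → Set α :=
    fun x => {(x.1 : α), (x.2.1 : α), (x.2.2 : α)} with htoEdge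
  set T : Finset (H.vertexSet × H.vertexSet × H.vertexSet) :=
    Finset.univ.filter fun x => toEdge x ∈ H.edgeSet ∧ f x.1 = 0 ∧ f x.2.1 = 1 ∧ f x.2.2 = 2
    with hT
  have h1 : ∑ u, ∑ v, ∑ w, H.edgeTensor u v w *
      (if f u = 0 ∧ f v = 1 ∧ f w = 2 then 1 else 0) = (T.card : ℝ) := by
    rw [hT, Finset.card_filter]
    push_cast
    simp only [Fintype.sum_prod_type, edgeTensor, htoEdge, ite_and, ite_mul, one_mul, zero_mul]
  rw [h1, cutSize, Set.ncard_eq_toFinset_card _ hfin]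
  refine Nat.cast_le.2 (Finset.card_le_card_of_injOn toEdge ?_ ?_)
  · rintro ⟨u, v, w⟩ hx
    simp only [hT, htoEdge, Finset.coe_filter, Finset.mem_univ, true_and, Set.mem_ofPred_eq] at hx
    simp only [Set.Finite.coe_toFinset, Set.mem_ofPred_eq, htoEdge]
    refine ⟨hx.1, fun i => ?_⟩
    fin_cases i
    · exact ⟨u, by simp, u, hx.2.1, rfl⟩
    · exact ⟨v, by simp, v, hx.2.2.1, rfl⟩
    · exact ⟨w, by simp, w, hx.2.2.2, rfl⟩
  · rintro ⟨u, v, w⟩ hx ⟨u', v', w'⟩ hx' heq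
    simp only [hT, Finset.coe_filter, Finset.mem_univ, true_and, Set.mem_ofPred_eq] at hx hx'
    have hmem : ∀ x : H.vertexSet, (x : α) ∈ toEdge (u, v, w) → x = u' ∨ x = v' ∨ x = w' := by
      intro x hx
      rw [heq] at hx
      simpa [htoEdge, Subtype.ext_iff] using hx
    have hu' := hmem u (by simp [htoEdge])
    have hv' := hmem v (by simp [htoEdge])
    have hw' := hmem w (by simp [htoEdge])
    grind

/-- Every linear 3-graph has a 3-cut exceeding the average by `m ^ (3 / 4) / (log m) ^ 2`, up to a
constant factor. -/
lemma IsLinear.exists_large_cut (hl : H.IsLinear) (hu : H.IsUniform 3) (hV : H.vertexSet.Finite)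
    (hm : 2 ≤ H.numEdges) :
    ∃ P : Fin 3 → Set α, H.IsVertexPartition P ∧
      (2 / 9 : ℝ) * H.numEdges + 1 / 92160 *
        ((H.numEdges : ℝ) ^ (3 / 4 : ℝ) / Real.log H.numEdges ^ 2) ≤ H.cutSize P := by
  classical
  have := hV.fintype
  have hm2 : (2 : ℝ) ≤ H.numEdges := by exact_mod_cast hm
  set m : ℝ := (H.numEdges : ℝ)
  have hh := edgeTensor_isLinearTensor hu hl
  set q : ℝ := m ^ (1 / 4 : ℝ) with hq
  have hq4 : q ^ 4 = m := by
    rw [hq, ← Real.rpow_natCast, ← Real.rpow_mul (by linarith)]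
    norm_num
  have hq3 : q ^ 3 = m ^ (3 / 4 : ℝ) := by
    rw [hq, ← Real.rpow_natCast, ← Real.rpow_mul (by linarith)]
    norm_num
  have hq0 : 0 < q := Real.rpow_pos_of_pos (by linarith) _
  obtain ⟨p, hp, hp1, hcut⟩ := exists_fractional_colouring hh hq0 hq4 hm2 (sum_edgeTensor hu)
  obtain ⟨f, hf⟩ := exists_colouring hh p hp hp1
  refine ⟨colourClass f, isVertexPartition_colourClass f, ?_⟩
  have h1 := sum_edgeTensor_le_cutSize f
  have hlog : 1 / 2 ≤ Real.log m :=
    (by linarith [Real.log_two_gt_d9] : (1 : ℝ) / 2 ≤ Real.log 2).trans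
      (Real.log_le_log (by norm_num) hm2)
  have h2 : 1 / 92160 * (q ^ 3 / Real.log m ^ 2) ≤ q ^ 3 / (46080 * Real.log m) := by
    rw [one_div_mul_eq_div, div_div, div_le_div_iff_of_pos_left (by positivity) (by positivity)
      (by positivity)]
    nlinarith
  rw [← hq3]
  linarith

end Hypergraph

/-! ### Random subsets -/

section RandomSubset

variable {ι : Type*} [DecidableEq ι]

/-- The expectation of `φ S`, where `S` is a random subset of `T` that contains every element
independently with probability `p`. -/
noncomputable def subsetExpect (p : ℝ) (T : Finset ι) (φ : Finset ι → ℝ) : ℝ :=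
  ∑ S ∈ T.powerset, p ^ S.card * (1 - p) ^ (T \ S).card * φ S

lemma subsetExpect_exp {p : ℝ} {T A : Finset ι} (hA : A ⊆ T) (l : ℝ) :
    subsetExpect p T (fun S => Real.exp (l * (S ∩ A).card)) =
      (1 - p + p * Real.exp l) ^ A.card := by
  have key := Finset.prod_add (fun i => p * if i ∈ A then Real.exp l else 1) (fun _ => 1 - p) T
  have h1 : ∏ i ∈ T, ((p * if i ∈ A then Real.exp l else 1) + (1 - p)) =
      (1 - p + p * Real.exp l) ^ A.card := by
    rw [← Finset.prod_subset hA, Finset.prod_congr rfl (g := fun _ => 1 - p + p * Real.exp l),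
      Finset.prod_const]
    · intro i hi
      rw [if_pos hi]; ring
    · intro i _ hi
      rw [if_neg hi]; ring
  rw [← h1, key, subsetExpect]
  refine Finset.sum_congr rfl fun S _ => ?_
  rw [Finset.prod_mul_distrib, Finset.prod_const, Finset.prod_const, Finset.prod_ite_mem,
    Finset.prod_const, ← Real.exp_nat_mul]
  ring_nf

lemma subsetExpect_exp_le {p : ℝ} (hp : 0 ≤ p) (hp1 : p ≤ 1) {T A : Finset ι} (hA : A ⊆ T)
    (l : ℝ) :
    subsetExpect p T (fun S => Real.exp (l * (S ∩ A).card)) ≤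
      Real.exp (p * A.card * (Real.exp l - 1)) := by
  rw [subsetExpect_exp hA]
  have h1 : 1 - p + p * Real.exp l ≤ Real.exp (p * (Real.exp l - 1)) := by
    have := Real.add_one_le_exp (p * (Real.exp l - 1))
    linarith
  have h0 : 0 ≤ 1 - p + p * Real.exp l := by
    have := mul_nonneg hp (Real.exp_nonneg l)
    linarith
  refine (pow_le_pow_left₀ h0 h1 _).trans_eq ?_
  rw [← Real.exp_nat_mul]
  ring_nf

lemma subsetExpect_add (p : ℝ) (T : Finset ι) (φ ψ : Finset ι → ℝ) :
    subsetExpect p T (fun S => φ S + ψ S) = subsetExpect p T φ + subsetExpect p T ψ := by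
  simp [subsetExpect, mul_add, Finset.sum_add_distrib]

lemma subsetExpect_sum {κ : Type*} (p : ℝ) (T : Finset ι) (s : Finset κ)
    (φ : κ → Finset ι → ℝ) :
    subsetExpect p T (fun S => ∑ k ∈ s, φ k S) = ∑ k ∈ s, subsetExpect p T (φ k) := by
  simp only [subsetExpect, Finset.mul_sum]
  exact Finset.sum_comm

lemma subsetExpect_mul_const (p : ℝ) (T : Finset ι) (φ : Finset ι → ℝ) (a : ℝ) :
    subsetExpect p T (fun S => φ S * a) = subsetExpect p T φ * a := by
  simp [subsetExpect, Finset.sum_mul, mul_assoc]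

/-- Chernoff's bound, stated for the exponential of the deviation. -/
lemma subsetExpect_exp_sub_le {p : ℝ} (hp : 0 ≤ p) (hp1 : p ≤ 1) {T A : Finset ι} (hA : A ⊆ T)
    (l b : ℝ) :
    subsetExpect p T (fun S => Real.exp (l * (S ∩ A).card - b)) ≤
      Real.exp (p * A.card * (Real.exp l - 1) - b) := by
  simp only [sub_eq_add_neg _ b, Real.exp_add]
  rw [subsetExpect_mul_const]
  exact mul_le_mul_of_nonneg_right (subsetExpect_exp_le hp hp1 hA l) (Real.exp_nonneg _)

lemma exists_lt_one_of_subsetExpect {p : ℝ} (hp : 0 ≤ p) (hp1 : p ≤ 1) {T : Finset ι}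
    {φ : Finset ι → ℝ} (h : subsetExpect p T φ < 1) : ∃ S ⊆ T, φ S < 1 := by
  by_contra! hge
  have h1 : subsetExpect p T (fun _ => 1) = 1 := by
    have := subsetExpect_exp (p := p) (Finset.empty_subset T) 0
    simpa using this
  refine absurd h (not_lt.2 ?_)
  rw [← h1]
  refine Finset.sum_le_sum fun S hS => ?_
  have := hge S (Finset.mem_powerset.1 hS)
  have h2 : 0 ≤ 1 - p := by linarith
  gcongr

end RandomSubset

/-! ### Counting triples -/

section Triples

variable {n : ℕ}

/-- All triples of vertices. -/
def triples (n : ℕ) : Finset (Finset (Fin n)) :=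
  Finset.univ.powersetCard 3

/-- The triples that have a vertex of each colour. -/
def rainbowTriples (f : Fin n → Fin 3) : Finset (Finset (Fin n)) :=
  (triples n).filter fun e => ∀ i, ∃ v ∈ e, f v = i

/-- The triples containing `u` and `v`. -/
def triplesThrough (u v : Fin n) : Finset (Finset (Fin n)) :=
  (triples n).filter fun e => u ∈ e ∧ v ∈ e

lemma rainbowTriples_subset (f : Fin n → Fin 3) : rainbowTriples f ⊆ triples n :=
  Finset.filter_subset _ _

lemma triplesThrough_subset (u v : Fin n) : triplesThrough u v ⊆ triples n :=
  Finset.filter_subset _ _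

lemma card_of_mem_triples {e : Finset (Fin n)} (he : e ∈ triples n) : e.card = 3 :=
  (Finset.mem_powersetCard.1 he).2

lemma mul_mul_le_cube_div {a b c : ℝ} (ha : 0 ≤ a) (hb : 0 ≤ b) (hc : 0 ≤ c) :
    a * b * c ≤ (a + b + c) ^ 3 / 27 := by
  have h := add_nonneg (add_nonneg ha hb) hc
  linarith [mul_nonneg ha (sq_nonneg (b - c)), mul_nonneg hb (sq_nonneg (a - c)),
    mul_nonneg hc (sq_nonneg (a - b)), mul_nonneg h (sq_nonneg (b - c)),
    mul_nonneg h (sq_nonneg (a - c)), mul_nonneg h (sq_nonneg (a - b))]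

lemma card_rainbowTriples_le (f : Fin n → Fin 3) :
    ((rainbowTriples f).card : ℝ) ≤ (n : ℝ) ^ 3 / 27 := by
  set F : Fin 3 → Finset (Fin n) := fun i => Finset.univ.filter fun v => f v = i with hF
  have h1 : rainbowTriples f ⊆
      (F 0 ×ˢ F 1 ×ˢ F 2).image fun x => {x.1, x.2.1, x.2.2} := by
    intro e he
    obtain ⟨heT, hr⟩ := Finset.mem_filter.1 he
    obtain ⟨u, hu, fu⟩ := hr 0
    obtain ⟨v, hv, fv⟩ := hr 1
    obtain ⟨w, hw, fw⟩ := hr 2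
    have huv : u ≠ v := by rintro rfl; simp [fu] at fv
    have huw : u ≠ w := by rintro rfl; simp [fu] at fw
    have hvw : v ≠ w := by rintro rfl; simp [fv] at fw
    refine Finset.mem_image.2 ⟨(u, v, w), by simp [hF, fu, fv, fw], ?_⟩
    refine Finset.eq_of_subset_of_card_le ?_ ?_
    · intro x hx
      simp only [Finset.mem_insert, Finset.mem_singleton] at hx
      rcases hx with rfl | rfl | rfl <;> assumption
    · rw [card_of_mem_triples heT, Finset.card_eq_three.2 ⟨u, v, w, huv, huw, hvw, rfl⟩]
  have h2 : (rainbowTriples f).card ≤ (F 0).card * ((F 1).card * (F 2).card) := by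
    refine (Finset.card_le_card h1).trans (Finset.card_image_le.trans_eq ?_)
    simp
  have h3 : (F 0).card + (F 1).card + (F 2).card = n := by
    have := Finset.card_eq_sum_card_fiberwise (s := (Finset.univ : Finset (Fin n))) (f := f)
      (t := Finset.univ) (by simp)
    simp only [Fin.sum_univ_three, Finset.card_univ, Fintype.card_fin] at this
    exact this.symm
  have h2' : ((rainbowTriples f).card : ℝ) ≤ (F 0).card * ((F 1).card * (F 2).card) := by
    exact_mod_cast h2
  have h3' : ((F 0).card : ℝ) + (F 1).card + (F 2).card = n := by
    exact_mod_cast h3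
  refine h2'.trans ?_
  rw [← mul_assoc, ← h3']
  exact mul_mul_le_cube_div (Nat.cast_nonneg _) (Nat.cast_nonneg _) (Nat.cast_nonneg _)

lemma card_triplesThrough_le {u v : Fin n} (huv : u ≠ v) : (triplesThrough u v).card ≤ n := by
  have h1 : triplesThrough u v ⊆ Finset.univ.image fun w => {u, v, w} := by
    intro e he
    obtain ⟨heT, hu, hv⟩ := Finset.mem_filter.1 he
    have hc : (e \ {u, v}).card = 1 := by
      rw [Finset.card_sdiff_of_subset (by simp [Finset.insert_subset_iff, hu, hv]),
        card_of_mem_triples heT, Finset.card_pair huv]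
    obtain ⟨w, hw⟩ := Finset.card_eq_one.1 hc
    refine Finset.mem_image.2 ⟨w, Finset.mem_univ w, ?_⟩
    have : {u, v} ∪ (e \ {u, v}) = e :=
      Finset.union_sdiff_of_subset (by simp [Finset.insert_subset_iff, hu, hv])
    rw [hw] at this
    rw [← this]
    ext x
    simp
  refine (Finset.card_le_card h1).trans (Finset.card_image_le.trans_eq ?_)
  simp

lemma card_triples (n : ℕ) : ((triples n).card : ℝ) = n * (n - 1) * (n - 2) / 6 := by
  rw [triples, Finset.card_powersetCard, Finset.card_univ, Fintype.card_fin]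
  induction n with
  | zero => simp
  | succ k ih =>
    rw [Nat.choose_succ_succ' k 2, Nat.cast_add, ih, Nat.cast_choose_two]
    push_cast
    ring

end Triples

/-! ### A random 3-graph without large cuts -/

/-- A sparse random set of triples satisfies all the required bounds at once: the sum of the
exponential moments of all the deviations has mean less than `1`. -/
lemma exists_triples {n : ℕ} (hn : 100 ≤ n) {x : ℝ} (hx : 0 < x) (hxn : x ^ 2 = n) :
    ∃ S ⊆ triples n, (∀ f : Fin n → Fin 3, ((S ∩ rainbowTriples f).card : ℝ) ≤
        (n : ℝ) ^ 2 / 27 + 3 * x ^ 3) ∧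
      (n : ℝ) ^ 2 / 6 - n / 2 - 3 * x ^ 3 ≤ S.card ∧ (S.card : ℝ) ≤ (n : ℝ) ^ 2 ∧
      ∀ u v, u ≠ v → ((S ∩ triplesThrough u v).card : ℝ) ≤ 4 * Real.log n := by
  have hnR : (100 : ℝ) ≤ n := by exact_mod_cast hn
  have hn0 : (0 : ℝ) < n := by linarith
  set p : ℝ := 1 / n with hp
  have hp0 : 0 ≤ p := by positivity
  have hp1 : p ≤ 1 := by rw [hp, div_le_one hn0]; linarith
  have hpn : p * n = 1 := by rw [hp]; field_simp
  -- With `l = 1 / √n` as the parameter in Chernoff's bound, a deviation of `3 n ^ (3 / 2)` costs a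
  -- factor `exp (-3 n)`, while the second-order term contributes at most `exp (n / 6)`.
  set l : ℝ := 1 / x with hl
  have hx1 : 1 ≤ x := by nlinarith
  have hl0 : 0 < l := by positivity
  have hl1 : l ≤ 1 := by rw [hl, div_le_one hx]; exact hx1
  have hlx : l * x = 1 := by rw [hl]; field_simp
  have hl2 : l ^ 2 * n = 1 := by rw [← hxn, ← mul_pow, hlx, one_pow]
  have hlx3 : l * x ^ 3 = n := by rw [← hxn]; linear_combination x ^ 2 * hlx
  have hN := card_triples n
  set N : ℝ := ((triples n).card : ℝ) with hNdef
  have hpN : p * N = (n : ℝ) ^ 2 / 6 - n / 2 + 1 / 3 := by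
    rw [hN]
    linear_combination ((n : ℝ) - 1) * (n - 2) / 6 * hpn
  set φ₁ : Finset (Finset (Fin n)) → ℝ := fun S => ∑ f : Fin n → Fin 3,
    Real.exp (l * (S ∩ rainbowTriples f).card - l * ((n : ℝ) ^ 2 / 27 + 3 * x ^ 3)) with hφ₁
  set φ₂ : Finset (Finset (Fin n)) → ℝ := fun S =>
    Real.exp (-l * (S ∩ triples n).card - -l * (p * N - 3 * x ^ 3)) with hφ₂
  set φ₃ : Finset (Finset (Fin n)) → ℝ := fun S =>
    Real.exp (1 * (S ∩ triples n).card - (n : ℝ) ^ 2) with hφ₃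
  set φ₄ : Finset (Finset (Fin n)) → ℝ := fun S => ∑ x ∈ (Finset.univ : Finset (Fin n)).offDiag,
    Real.exp (1 * (S ∩ triplesThrough x.1 x.2).card - 4 * Real.log n) with hφ₄
  -- The sums `φ₁`, `φ₂`, `φ₃`, `φ₄` are responsible for the cuts, the lower and the upper bound on the
  -- number of edges, and the co-degrees.
  have he : Real.exp 1 ≤ 3 := by linarith [Real.exp_one_lt_d9]
  have hsmall : Real.exp (-(n / 2 : ℝ)) ≤ 1 / 50 := by
    rw [Real.exp_neg, inv_le_comm₀ (Real.exp_pos _) (by norm_num)]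
    have := Real.add_one_le_exp (n / 2 : ℝ)
    linarith
  have b₁ : subsetExpect p (triples n) φ₁ ≤ 1 / 50 := by
    -- The `3 ^ n` colourings are absorbed by `3 ≤ exp 2`.
    rw [hφ₁, subsetExpect_sum]
    have h1 : ∀ f : Fin n → Fin 3, subsetExpect p (triples n) (fun S =>
        Real.exp (l * (S ∩ rainbowTriples f).card - l * ((n : ℝ) ^ 2 / 27 + 3 * x ^ 3))) ≤
        Real.exp (-(5 / 2) * n) := by
      intro f
      refine (subsetExpect_exp_sub_le hp0 hp1 (rainbowTriples_subset f) l _).trans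
        (Real.exp_le_exp.2 ?_)
      have h2 : Real.exp l - 1 ≤ l + l ^ 2 := by
        have := Real.abs_exp_sub_one_sub_id_le (x := l) (by rwa [abs_of_pos hl0])
        linarith [le_abs_self (Real.exp l - 1 - l)]
      have h3 : p * (rainbowTriples f).card ≤ (n : ℝ) ^ 2 / 27 := by
        calc p * (rainbowTriples f).card ≤ p * ((n : ℝ) ^ 3 / 27) := by
              gcongr; exact card_rainbowTriples_le f
          _ = (n : ℝ) ^ 2 / 27 := by linear_combination (n : ℝ) ^ 2 / 27 * hpn
      have h4 : p * (rainbowTriples f).card * (Real.exp l - 1) ≤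
          (n : ℝ) ^ 2 / 27 * (l + l ^ 2) := by
        refine mul_le_mul h3 h2 ?_ (by positivity)
        linarith [Real.add_one_le_exp l]
      have h5 : (n : ℝ) ^ 2 / 27 * (l + l ^ 2) = l * ((n : ℝ) ^ 2 / 27) + n / 27 := by
        linear_combination (n : ℝ) / 27 * hl2
      linarith
    refine (Finset.sum_le_sum fun f _ => h1 f).trans ?_
    rw [Finset.sum_const, Finset.card_univ, Fintype.card_fun, Fintype.card_fin, Fintype.card_fin,
      nsmul_eq_mul]
    have h3 : (3 : ℝ) ≤ Real.exp 2 := by linarith [Real.add_one_le_exp 2]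
    push_cast
    calc (3 : ℝ) ^ n * Real.exp (-(5 / 2) * n) ≤ Real.exp 2 ^ n * Real.exp (-(5 / 2) * n) := by
          gcongr
      _ = Real.exp (-(n / 2 : ℝ)) := by
          rw [← Real.exp_nat_mul, ← Real.exp_add]
          ring_nf
      _ ≤ 1 / 50 := hsmall
  have b₂ : subsetExpect p (triples n) φ₂ ≤ 1 / 50 := by
    refine (subsetExpect_exp_sub_le hp0 hp1 subset_rfl (-l) _).trans (le_trans
      (Real.exp_le_exp.2 ?_) hsmall)
    have h2 : Real.exp (-l) - 1 ≤ -l + l ^ 2 := by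
      have := Real.abs_exp_sub_one_sub_id_le (x := -l) (by rwa [abs_neg, abs_of_pos hl0])
      rw [neg_sq] at this
      linarith [le_abs_self (Real.exp (-l) - 1 - -l)]
    have hpN0 : 0 ≤ p * N := by positivity
    have h3 := mul_le_mul_of_nonneg_left h2 hpN0
    have h4 : p * N * l ^ 2 ≤ (n : ℝ) / 6 := by
      calc p * N * l ^ 2 ≤ (n : ℝ) ^ 2 / 6 * l ^ 2 := by
            gcongr; rw [hpN]; linarith
        _ = (n : ℝ) / 6 := by linear_combination (n : ℝ) / 6 * hl2
    rw [← hNdef]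
    linarith
  have b₃ : subsetExpect p (triples n) φ₃ ≤ 1 / 50 := by
    refine (subsetExpect_exp_sub_le hp0 hp1 subset_rfl 1 _).trans (le_trans
      (Real.exp_le_exp.2 ?_) hsmall)
    rw [← hNdef]
    have h1 : p * N ≤ (n : ℝ) ^ 2 / 6 := by rw [hpN]; linarith
    have h2 : p * N * (Real.exp 1 - 1) ≤ (n : ℝ) ^ 2 / 6 * 2 := by
      refine mul_le_mul h1 (by linarith) ?_ (by positivity)
      linarith [Real.add_one_le_exp 1]
    nlinarith
  have b₄ : subsetExpect p (triples n) φ₄ ≤ 1 / 50 := by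
    rw [hφ₄, subsetExpect_sum]
    have h1 : ∀ y ∈ (Finset.univ : Finset (Fin n)).offDiag, subsetExpect p (triples n) (fun S =>
        Real.exp (1 * (S ∩ triplesThrough y.1 y.2).card - 4 * Real.log n)) ≤ 9 / (n : ℝ) ^ 4 := by
      intro y hy
      refine (subsetExpect_exp_sub_le hp0 hp1 (triplesThrough_subset _ _) 1 _).trans ?_
      have h2 : ((triplesThrough y.1 y.2).card : ℝ) ≤ n := by
        exact_mod_cast card_triplesThrough_le (Finset.mem_offDiag.1 hy).2.2
      have h3 : p * (triplesThrough y.1 y.2).card ≤ 1 := by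
        rw [← hpn]; gcongr
      have h4 : p * (triplesThrough y.1 y.2).card * (Real.exp 1 - 1) ≤ 2 := by
        have : 0 ≤ p * (triplesThrough y.1 y.2).card := by positivity
        nlinarith [Real.add_one_le_exp 1]
      have h5 : Real.exp (4 * Real.log n) = (n : ℝ) ^ 4 := by
        rw [mul_comm, Real.exp_mul, Real.exp_log hn0]
        norm_cast
      rw [Real.exp_sub, h5]
      gcongr
      calc _ ≤ Real.exp (1 + 1) := Real.exp_le_exp.2 (by linarith)
        _ = Real.exp 1 * Real.exp 1 := Real.exp_add 1 1
        _ ≤ 3 * 3 := by gcongr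
        _ = 9 := by norm_num
    refine (Finset.sum_le_sum h1).trans ?_
    rw [Finset.sum_const, nsmul_eq_mul]
    have h2 : ((Finset.univ : Finset (Fin n)).offDiag.card : ℝ) ≤ (n : ℝ) ^ 2 := by
      rw [Finset.offDiag_card, Finset.card_univ, Fintype.card_fin]
      exact_mod_cast (Nat.sub_le _ _).trans_eq (sq n).symm
    calc _ ≤ (n : ℝ) ^ 2 * (9 / (n : ℝ) ^ 4) := by gcongr
      _ = 9 / (n : ℝ) ^ 2 := by field_simp
      _ ≤ 1 / 50 := by
        rw [div_le_div_iff₀ (by positivity) (by norm_num)]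
        nlinarith
  have htotal : subsetExpect p (triples n) (fun S => φ₁ S + φ₂ S + φ₃ S + φ₄ S) < 1 := by
    rw [subsetExpect_add, subsetExpect_add, subsetExpect_add]
    linarith
  obtain ⟨S, hST, hS⟩ := exists_lt_one_of_subsetExpect hp0 hp1 htotal
  have p₁ : 0 ≤ φ₁ S := Finset.sum_nonneg fun _ _ => Real.exp_nonneg _
  have p₂ : 0 ≤ φ₂ S := Real.exp_nonneg _
  have p₃ : 0 ≤ φ₃ S := Real.exp_nonneg _
  have p₄ : 0 ≤ φ₄ S := Finset.sum_nonneg fun _ _ => Real.exp_nonneg _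
  have hinter : S ∩ triples n = S := Finset.inter_eq_left.2 hST
  refine ⟨S, hST, fun f => ?_, ?_, ?_, fun u v huv => ?_⟩
  · have h1 := Finset.single_le_sum (f := fun f : Fin n → Fin 3 => Real.exp
      (l * (S ∩ rainbowTriples f).card - l * ((n : ℝ) ^ 2 / 27 + 3 * x ^ 3)))
      (fun _ _ => Real.exp_nonneg _) (Finset.mem_univ f)
    have h2 := Real.exp_lt_one_iff.1 (lt_of_le_of_lt h1 (by linarith : φ₁ S < 1))
    rw [← mul_sub] at h2
    linarith [neg_of_mul_neg_right h2 hl0.le]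
  · have h2 := Real.exp_lt_one_iff.1 (by linarith : φ₂ S < 1)
    rw [hinter, ← mul_sub, neg_mul, neg_lt_zero] at h2
    linarith [(mul_pos_iff_of_pos_left hl0).1 h2]
  · have h2 := Real.exp_lt_one_iff.1 (by linarith : φ₃ S < 1)
    rw [hinter] at h2
    linarith
  · have h1 := Finset.single_le_sum (f := fun y : Fin n × Fin n => Real.exp
      (1 * (S ∩ triplesThrough y.1 y.2).card - 4 * Real.log n))
      (fun _ _ => Real.exp_nonneg _)
      ((Finset.mem_offDiag (x := (u, v))).2 ⟨Finset.mem_univ u, Finset.mem_univ v, huv⟩)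
    have h2 := Real.exp_lt_one_iff.1 (lt_of_le_of_lt h1 (by linarith : φ₄ S < 1))
    simp only at h2
    linarith

namespace Hypergraph

variable {n : ℕ}

/-- The hypergraph on `Fin n` with edge set `S`. -/
def ofFinset (S : Finset (Finset (Fin n))) : Hypergraph (Fin n) where
  vertexSet := Set.univ
  edgeSet := (fun e : Finset (Fin n) => (e : Set (Fin n))) '' S
  subset_vertexSet_of_mem_edgeSet' _ _ := Set.subset_univ _

lemma ofFinset_isUniform {S : Finset (Finset (Fin n))} (hS : S ⊆ triples n) :
    (ofFinset S).IsUniform 3 := by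
  rintro _ ⟨e, he, rfl⟩
  rw [Set.encard_coe_eq_coe_finsetCard, card_of_mem_triples (hS he)]

lemma ncard_image_coe (S : Finset (Finset (Fin n))) :
    ((fun e : Finset (Fin n) => (e : Set (Fin n))) '' (S : Set (Finset (Fin n)))).ncard =
      S.card := by
  rw [Set.ncard_image_of_injective _ Finset.coe_injective, Set.ncard_coe_finset]

lemma numEdges_ofFinset (S : Finset (Finset (Fin n))) : (ofFinset S).numEdges = S.card :=
  ncard_image_coe S

lemma codegree_ofFinset_le {S : Finset (Finset (Fin n))} (hS : S ⊆ triples n) (u v : Fin n) :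
    (ofFinset S).codegree u v ≤ (S ∩ triplesThrough u v).card := by
  rw [← ncard_image_coe, codegree]
  refine Set.ncard_le_ncard ?_ (Set.toFinite _)
  rintro _ ⟨⟨e, he, rfl⟩, hu, hv⟩
  exact ⟨e, Finset.mem_coe.2 (Finset.mem_inter.2 ⟨he, Finset.mem_filter.2 ⟨hS he, hu, hv⟩⟩), rfl⟩

lemma exists_cutSize_ofFinset_le {S : Finset (Finset (Fin n))} (hS : S ⊆ triples n)
    {P : Fin 3 → Set (Fin n)} (hP : (ofFinset S).IsVertexPartition P) :
    ∃ f : Fin n → Fin 3, (ofFinset S).cutSize P ≤ (S ∩ rainbowTriples f).card := by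
  have hmem : ∀ v, ∃ i, v ∈ P i := fun v => by
    have : v ∈ ⋃ i, P i := by rw [hP.2]; exact Set.mem_univ v
    simpa using this
  choose f hf using hmem
  refine ⟨f, ?_⟩
  rw [← ncard_image_coe, cutSize]
  refine Set.ncard_le_ncard ?_ (Set.toFinite _)
  rintro _ ⟨⟨e, he, rfl⟩, hcut⟩
  refine ⟨e, Finset.mem_coe.2 (Finset.mem_inter.2 ⟨he, Finset.mem_filter.2 ⟨hS he, fun i => ?_⟩⟩),
    rfl⟩
  obtain ⟨v, hve, hvi⟩ := hcut i
  refine ⟨v, hve, ?_⟩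
  by_contra hne
  exact Set.disjoint_left.1 (hP.1 _ _ hne) (hf v) hvi

end Hypergraph

theorem theorem1p2 :
    -- every linear 3-graph has a large 3-cut
    (∃ c : ℝ, 0 < c ∧
      ∀ (α : Type*) (H : Hypergraph α), H.vertexSet.Finite → H.IsUniform 3 → H.IsLinear →
        ∀ m : ℕ, 2 ≤ m → H.numEdges = m →
          ∃ P : Fin 3 → Set α, H.IsVertexPartition P ∧
            (2 / 9 : ℝ) * m + c * ((m : ℝ) ^ (3 / 4 : ℝ) / Real.log m ^ 2) ≤ H.cutSize P) ∧
    -- the exponent cannot be improved for 3-graphs with logarithmic co-degrees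
    (∃ c C : ℝ, 0 < c ∧ 0 < C ∧
      ∀ᶠ n : ℕ in atTop, ∃ H : Hypergraph (Fin n),
        H.vertexSet = Set.univ ∧ H.IsUniform 3 ∧
        c * (n : ℝ) ^ 2 ≤ H.numEdges ∧ (H.numEdges : ℝ) ≤ C * (n : ℝ) ^ 2 ∧
        (∀ u v : Fin n, u ≠ v → (H.codegree u v : ℝ) ≤ C * Real.log n) ∧
        ∀ P : Fin 3 → Set (Fin n), H.IsVertexPartition P →
          (H.cutSize P : ℝ) ≤
            (2 / 9 : ℝ) * H.numEdges + C * (H.numEdges : ℝ) ^ (3 / 4 : ℝ)) := by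
  constructor
  · refine ⟨1 / 92160, by norm_num, fun α H hV hu hl m hm hHm => ?_⟩
    subst hHm
    exact hl.exists_large_cut hu hV hm
  · -- The excess of a cut is at most `5 n ^ (3 / 2)`, and `m ≥ n ^ 2 / 16` gives
    -- `m ^ (3 / 4) ≥ n ^ (3 / 2) / 8`.
    refine ⟨1 / 16, 40, by norm_num, by norm_num, ?_⟩
    filter_upwards [eventually_ge_atTop 2500] with n hn
    have hnR : (2500 : ℝ) ≤ n := by exact_mod_cast hn
    set x : ℝ := √n with hxdef
    have hxn : x ^ 2 = n := Real.sq_sqrt (by linarith)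
    have hx50 : 50 ≤ x := Real.le_sqrt_of_sq_le (by linarith)
    have hx : 0 < x := by linarith
    obtain ⟨S, hST, hcut, hlow, hup, hcodeg⟩ := exists_triples (by lia) hx hxn
    have hlow' : 1 / 16 * (n : ℝ) ^ 2 ≤ S.card := by
      refine le_trans ?_ hlow
      rw [← hxn]
      nlinarith [pow_pos hx 3, mul_le_mul_of_nonneg_left hx50 (pow_pos hx 3).le,
        mul_le_mul_of_nonneg_left hx50 (pow_pos hx 2).le]
    refine ⟨Hypergraph.ofFinset S, rfl, Hypergraph.ofFinset_isUniform hST, ?_, ?_, ?_, ?_⟩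
    · rw [Hypergraph.numEdges_ofFinset]
      exact hlow'
    · rw [Hypergraph.numEdges_ofFinset]
      nlinarith [sq_nonneg (n : ℝ)]
    · intro u v huv
      have h1 : ((Hypergraph.ofFinset S).codegree u v : ℝ) ≤ (S ∩ triplesThrough u v).card := by
        exact_mod_cast Hypergraph.codegree_ofFinset_le hST u v
      have h2 : 0 ≤ Real.log n := Real.log_nonneg (by linarith)
      linarith [hcodeg u v huv]
    · intro P hP
      obtain ⟨f, hf⟩ := Hypergraph.exists_cutSize_ofFinset_le hST hP
      have h1 : ((Hypergraph.ofFinset S).cutSize P : ℝ) ≤ (S ∩ rainbowTriples f).card := by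
        exact_mod_cast hf
      rw [Hypergraph.numEdges_ofFinset]
      have h2 : x ^ 3 / 8 ≤ (S.card : ℝ) ^ (3 / 4 : ℝ) := by
        have h3 : x ^ 3 / 8 = ((x / 2) ^ 4) ^ (3 / 4 : ℝ) := by
          rw [← Real.rpow_natCast (x / 2) 4, ← Real.rpow_mul (by positivity),
            show ((4 : ℕ) : ℝ) * (3 / 4) = (3 : ℕ) by norm_num, Real.rpow_natCast]
          ring
        rw [h3]
        refine Real.rpow_le_rpow (by positivity) (le_trans (le_of_eq ?_) hlow') (by norm_num)
        rw [← hxn]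
        ring
      have h3 := hcut f
      have h4 : (n : ℝ) ≤ x ^ 3 := by
        rw [← hxn]
        nlinarith [pow_pos hx 2]
      linarith
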